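/- Let $F:\mathbf{Set}\to\mathbf{Set}$ be a finitary functor with $F\emptyset\neq\emptyset$, and let $\varepsilon: H_\Sigma\twoheadrightarrow F$ be a presentation of $F$: $\Sigma=(\Sigma_n)_{n\in\mathbb N}$ is a finitary signature, $H_\Sigma X=\coprod_{n}\Sigma_n\times X^n$, and $\varepsilon$ is a natural transformation with surjective components. Choose a nullary symbol $p'\in\Sigma_0$ and put $p=\varepsilon_\emptyset(p')\in F\emptyset$. Then $F$ has an initial algebra $\varphi:F(\mu F)\to\mu F$ and a terminal coalgebra $\tau:\nu F\to F(\nu F)$, and the following holds with the notation below. *Cutting maps.* Let $i_n:F^n\emptyset\to\mu F$ be given by $i_{n+1}=\varphi\cdot Fi_n$ (with $i_0$ the empty map), let $t_n:\nu F\to F^n1$ be given by $t_{n+1}=Ft_n\cdot\tau$ (with $t_0$ the unique map to $1$), regard $p$ as a map $1\to F\emptyset$, and put $\partial_n=i_{n+1}\cdot F^np\cdot t_n:\nu F\to\mu F$. Let $m:\mu F\to\nu F$ be the unique coalgebra homomorphism from $(\mu F,\varphi^{-1})$ to $(\nu F,\tau)$. *Order by cutting.* Let $\nu H_\Sigma$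 be the set of all $\Sigma$-trees, with tree tupling $\tau'$, and $\mu H_\Sigma\subseteq \nu H_\Sigma$ the set of finite ones. For a $\Sigma$-tree $s$ let $\partial'_ns$ be the finite tree obtained by cutting away all nodes of height $>n$ and relabelling all nodes of height $n$ by $p'$. Let $\sim$ be the least congruence on the $\Sigma$-algebra $\mu H_\Sigma$ identifying $\sigma(s_1,\dots,s_k)$ and $\rho(t_1,\dots,t_l)$ whenever $\varepsilon_{\mu H_\Sigma}$ merges these two elements of $H_\Sigma(\mu H_\Sigma)$. Write $s\mapsto[s]$ for the unique homomorphism of $F$-coalgebras from $(\nu H_\Sigma,\varepsilon_{\nu H_\Sigma}\cdot\tau')$ to $(\nu F,\tau)$. For $x,y\in\nu F$ put $x\le y$ iff $x=y$, or there are $n\in\mathbb N$, a finite tree $s$ and a tree $s'$ with $x=[s]$, $y=[s']$ and $s\sim\partial'_ns'$. *Theorem.* The map $m$ is injective and $\le$ is a partial order on $\nu F$; order $(\nu F)^X$ pointwise, for every set $X$, and regard $(\mu F)^X$ as a subposet via $m$. Let $e:X\to FX+\nu F$ be any recursive equation. Define the approximate solutions $e^\dagger_k:X\to\mu F$ by letting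 $e^\dagger_0$ be the constant map with value $i_1(p)$, and $$e^\dagger_{k+1}=[\varphi,\mathrm{id}]\cdot(Fe^\dagger_k+\mathrm{id})\cdot(\mathrm{id}+\partial_{k+1})\cdot e .$$ Then $e^\dagger_0$ is the least element of $(\mu F)^X$, the maps $m\cdot e^\dagger_k$ form an $\omega$-chain $m\cdot e^\dagger_0\le m\cdot e^\dagger_1\le\cdots$ in $(\nu F)^X$, there is a unique solution $e^\dagger:X\to\nu F$ of $e$ in the algebra $(\nu F,\tau^{-1})$, i.e. a unique map with $e^\dagger=[\tau^{-1},\mathrm{id}]\cdot(Fe^\dagger+\mathrm{id})\cdot e$, and $$e^\dagger=\bigsqcup_{k\in\mathbb N}m\cdot e^\dagger_k\quad\text{in }(\nu F)^X .$$ -/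

import Mathlib

open CategoryTheory CategoryTheory.Limits

universe u

namespace IterAlg

/-- A finitary signature: for every `n` a set `Op n` of `n`-ary operation symbols. -/
structure Signature where
  Op : ℕ → Type u

namespace Signature

variable (S : Signature.{u})

/-- The polynomial with one summand `X ^ n` for every `n`-ary operation symbol. -/
def poly : PFunctor.{u, 0} := ⟨Σ n : ℕ, S.Op n, fun a => Fin a.1⟩

/-- The polynomial functor `H_Σ X = ∐ n, Σ_n × X ^ n`. -/
def H : Type u ⥤ Type u where
  obj X := S.poly X
  map f := TypeCat.ofHom (S.poly.map f)

/-- The element `σ(x_1, …, x_n)` of `H_Σ X`. -/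
def op {X : Type u} {n : ℕ} (σ : S.Op n) (x : Fin n → X) : S.H.obj X :=
  (⟨⟨n, σ⟩, x⟩ : S.poly X)

/-- `μ H_Σ`: the finite `Σ`-trees. -/
def FinTree : Type u := S.poly.W

/-- `ν H_Σ`: all `Σ`-trees, finite or infinite. -/
def Tree : Type u := S.poly.M

variable {S}

/-- Tree tupling on finite trees, `φ' : H_Σ (μ H_Σ) → μ H_Σ`. -/
def FinTree.mk (a : S.H.obj S.FinTree) : S.FinTree := PFunctor.W.mk (P := S.poly) a

/-- The `Σ`-coalgebra structure `τ' : ν H_Σ → H_Σ (ν H_Σ)` of all `Σ`-trees: it sends a tree to its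
root label together with the family of its maximal proper subtrees. -/
def Tree.dest (t : S.Tree) : S.H.obj S.Tree := PFunctor.M.dest (F := S.poly) t

/-- The inclusion `m'` of finite trees into all trees. -/
def FinTree.toTree : S.FinTree → S.Tree
  | WType.mk a f => PFunctor.M.mk (F := S.poly) ⟨a, fun i => FinTree.toTree (f i)⟩

/-- The cutting `∂'_n` of a tree at height `n`: all nodes of height larger than `n` are cut away,
and all nodes of height `n` (which become leaves) are relabelled by the nullary symbol `p'`. -/
def Tree.cut (p' : S.Op 0) : ℕ → S.Tree → S.FinTree
  | 0, _ => FinTree.mk (S.op p' Fin.elim0)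
  | n + 1, t => FinTree.mk (S.poly.map (Tree.cut p' n) t.dest)

end Signature

/-- A presentation of a set functor `F`: a finitary signature `Σ` together with a natural
transformation `ε : H_Σ ⟶ F` all of whose components are surjective. -/
structure Presentation (F : Type u ⥤ Type u) where
  sig : Signature.{u}
  ε : sig.H ⟶ F
  surj : ∀ X : Type u, Function.Surjective (ε.app X)

section Iteration

variable (F : Type u ⥤ Type u)

/-- The initial-algebra chain `F^n 0`. -/
def initObj : ℕ → Type u
  | 0 => PEmpty.{u + 1}
  | n + 1 => F.obj (initObj n)

/-- The terminal-coalgebra chain `F^n 1`. -/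
def termObj : ℕ → Type u
  | 0 => PUnit.{u + 1}
  | n + 1 => F.obj (termObj n)

variable {F}

/-- `F^n p : F^n 1 → F^n (F 0) = F^(n+1) 0` for an element `p : 1 → F 0`. -/
def powPoint (p : F.obj PEmpty.{u + 1}) : (n : ℕ) → (termObj F n ⟶ initObj F (n + 1))
  | 0 => TypeCat.ofHom fun _ => p
  | n + 1 => F.map (powPoint p n)

/-- The cocone `i_n : F^n 0 → A` of an algebra `A` on the initial-algebra chain; for the initial
algebra this is the colimit cocone. -/
def initCocone (A : Endofunctor.Algebra F) : (n : ℕ) → (initObj F n ⟶ A.a)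
  | 0 => TypeCat.ofHom PEmpty.elim
  | n + 1 => F.map (initCocone A n) ≫ A.str

/-- The cone `t_n : C → F^n 1` of a coalgebra `C` on the terminal-coalgebra chain. -/
def termCone (C : Endofunctor.Coalgebra F) : (n : ℕ) → (C.V ⟶ termObj F n)
  | 0 => TypeCat.ofHom fun _ => PUnit.unit
  | n + 1 => C.str ≫ F.map (termCone C n)

/-- The cutting map `∂_n = i_(n+1) ∘ F^n p ∘ t_n : ν F → μ F`. -/
def cutMap (I : Endofunctor.Algebra F) (T : Endofunctor.Coalgebra F)
    (p : F.obj PEmpty.{u + 1}) (n : ℕ) : T.V ⟶ I.a :=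
  termCone T n ≫ powPoint p n ≫ initCocone I (n + 1)

/-- The element `i_1 (p)` of `μ F` given by `p ∈ F 0`. -/
def bottom (I : Endofunctor.Algebra F) (p : F.obj PEmpty.{u + 1}) : I.a :=
  initCocone I 1 p

/-- `m : μ F → ν F`, the unique coalgebra homomorphism from `(μ F, φ⁻¹)` to `(ν F, τ)`. -/
def incl {I : Endofunctor.Algebra F} (hI : IsInitial I)
    {T : Endofunctor.Coalgebra F} (hT : IsTerminal T) : I.a ⟶ T.V :=
  (hT.from ⟨I.a, Endofunctor.Algebra.Initial.strInv hI⟩).f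

/-- `s` is a solution in the algebra `A` of the recursive equation `e : X → F X + A`. -/
def IsSolution (A : Endofunctor.Algebra F) {X : Type u} (e : X → F.obj X ⊕ A.a)
    (s : X → A.a) : Prop :=
  ∀ x, s x = Sum.elim (fun a => A.str (F.map (TypeCat.ofHom s) a)) id (e x)

/-- The `F`-algebra `(ν F, τ⁻¹)`. -/
abbrev terminalAlgebra {T : Endofunctor.Coalgebra F} (hT : IsTerminal T) : Endofunctor.Algebra F :=
  ⟨T.V, Endofunctor.Coalgebra.Terminal.strInv hT⟩

/-- The approximate solutions `e†_k : X → μ F` of `e : X → F X + ν F`: `e†_0` is constant with value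
`i_1 (p)`, the least element of `μ F`, and
`e†_(k+1) = [φ, id] ∘ (F e†_k + id) ∘ (id + ∂_(k+1)) ∘ e`. -/
def approx (I : Endofunctor.Algebra F) (T : Endofunctor.Coalgebra F)
    (p : F.obj PEmpty.{u + 1}) {X : Type u} (e : X → F.obj X ⊕ T.V) : ℕ → X → I.a
  | 0 => fun _ => bottom I p
  | k + 1 => fun x =>
      Sum.elim (fun a => I.str (F.map (TypeCat.ofHom (approx I T p e k)) a)) id
        (Sum.map id (cutMap I T p (k + 1)) (e x))

end Iteration

namespace Presentation

variable {F : Type u ⥤ Type u} (P : Presentation F)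

/-- The element `p = ε_0 (p')` of `F 0` given by a nullary symbol `p'`. -/
def point (p' : P.sig.Op 0) : F.obj PEmpty.{u + 1} :=
  P.ε.app PEmpty.{u + 1} (P.sig.op p' Fin.elim0)

/-- The congruence `∼` of a finite application of `ε`-equations: the least congruence on the algebra
of finite `Σ`-trees that contains all (instances of) equations
`σ(s_1, …, s_n) = ρ(t_1, …, t_m)` whose two sides are merged by `ε`. -/
inductive Cong : P.sig.FinTree → P.sig.FinTree → Prop
  | eqn (a b : P.sig.H.obj P.sig.FinTree)
      (h : P.ε.app P.sig.FinTree a = P.ε.app P.sig.FinTree b) :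
      Cong (Signature.FinTree.mk a) (Signature.FinTree.mk b)
  | app {n : ℕ} (σ : P.sig.Op n) (s t : Fin n → P.sig.FinTree) (h : ∀ i, Cong (s i) (t i)) :
      Cong (Signature.FinTree.mk (P.sig.op σ s)) (Signature.FinTree.mk (P.sig.op σ t))
  | refl (s : P.sig.FinTree) : Cong s s
  | symm {s t : P.sig.FinTree} (h : Cong s t) : Cong t s
  | trans {r s t : P.sig.FinTree} (h : Cong r s) (h' : Cong s t) : Cong r t

/-- `ν H_Σ` as a coalgebra for `F`, with structure `ε ∘ τ'`. -/
abbrev treeCoalgebra : Endofunctor.Coalgebra F :=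
  ⟨P.sig.Tree, TypeCat.ofHom Signature.Tree.dest ≫ P.ε.app P.sig.Tree⟩

/-- The quotient map `k̂ : ν H_Σ → ν F`, `s ↦ [s]`: the unique homomorphism of `F`-coalgebras. -/
def quot {T : Endofunctor.Coalgebra F} (hT : IsTerminal T) (s : P.sig.Tree) : T.V :=
  (hT.from P.treeCoalgebra).f s

/-- The order by cutting on `ν F`: `x ≤ y` iff `x = y`, or `x = [s]` and `y = [s']` for trees with
`s ∼ ∂'_n s'` for some `n`. -/
def CutLE (p' : P.sig.Op 0) {T : Endofunctor.Coalgebra F} (hT : IsTerminal T) (x y : T.V) : Prop :=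
  x = y ∨ ∃ (s : P.sig.FinTree) (s' : P.sig.Tree) (n : ℕ),
    P.quot hT s.toTree = x ∧ P.quot hT s' = y ∧ P.Cong s (s'.cut p' n)

end Presentation

end IterAlg

/-!
The presentation `ε : H_Σ ⟶ F` reduces everything to `Σ`-trees: every element of `F X` is the value
of `ε` at an operation symbol with finitely many arguments, hence has finite support.

*Fixed points.* The initial algebra is the algebra of finite trees modulo the congruence `∼`
(`isInitialCongQuotient`). The terminal coalgebra is the coalgebra of all trees modulo behavioural
equivalence, which identifies two trees if all the maps `t_n` into the chain `F^n 1` do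
(`isTerminalBehaviourQuotient`). That the coalgebra structure descends to this quotient `Q` is the
place where finite arities matter: two elements of `F Q` have a common finite support, on which a
single map `Q → F^n 1` is injective (`map_mk_str_eq`). Consequently the maps `t_n` jointly separate
the elements of `ν F` (`eq_of_termCone_eq`), and so do the cutting maps (`eq_of_cutMap_eq`), because
`t_n ∘ m ∘ ∂_n = t_n`.

*The order.* On representing trees the map `∂_n` is the cutting of trees at height `n`
(`cutMap_quot`). This gives `∂_n ∘ m ∘ ∂_k = ∂_(min n k)`, and that every `x` in `μ F` satisfies
`∂_k (m x) = x` for all large `k`; so `m` is injective. Moreover `x ≤ y` says just that `x = y` or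
`x = m (∂_n y)` for some `n` (`cutLE_iff`), from which one sees that `≤` is a partial order, that the
cuttings of `y` form a chain, and that `y` is their least upper bound
(`cutLE_of_forall_incl_cutMap`).

*Solutions.* A solution `s` of a recursive equation satisfies `e†_k = ∂_k ∘ s` by induction on `k`
(`approx_eq_cutMap`). So a solution is unique, and the statements on the approximate solutions are
those on the cuttings of the elements `s x`.
-/

namespace IterAlg

/-! ### Cutting trees -/

namespace Signature

variable {S : Signature.{u}}

instance fintypePolyB (a : S.poly.A) : Fintype (S.poly.B a) :=
  inferInstanceAs (Fintype (Fin a.1))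

theorem Tree.dest_toTree_mk (a : S.H.obj S.FinTree) :
    (FinTree.mk a).toTree.dest = S.poly.map FinTree.toTree a := by
  obtain ⟨a, f⟩ := a
  exact PFunctor.M.dest_mk _

theorem FinTree.mk_op_elim0 (σ : S.Op 0) (x : Fin 0 → S.FinTree) :
    FinTree.mk (S.op σ x) = FinTree.mk (S.op σ Fin.elim0) := by
  rw [Subsingleton.elim x Fin.elim0]

theorem Tree.cut_toTree_cut (p' : S.Op 0) (n k : ℕ) (t : S.Tree) :
    Tree.cut p' n (Tree.cut p' k t).toTree = Tree.cut p' (min n k) t := by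
  induction n generalizing k t with
  | zero => rw [Nat.zero_min]; rfl
  | succ n ih =>
    cases k with
    | zero =>
      rw [Nat.min_zero]
      exact FinTree.mk_op_elim0 p' _
    | succ k =>
      rw [Nat.succ_min_succ]
      change FinTree.mk (S.poly.map (Tree.cut p' n) (Tree.dest (FinTree.toTree (FinTree.mk _)))) =
        FinTree.mk (S.poly.map (Tree.cut p' (min n k)) t.dest)
      refine congrArg FinTree.mk ?_
      refine (congrArg (S.poly.map _) (Tree.dest_toTree_mk _)).trans ?_
      refine (congrArg (S.poly.map _) (PFunctor.map_map _ _ _ _)).trans ?_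
      refine (PFunctor.map_map _ _ _ _).trans ?_
      exact congrArg (fun g => S.poly.map g t.dest) (funext fun s => ih k s)

/-- A finite tree is unchanged by cutting at or above its height. -/
theorem FinTree.exists_forall_cut_toTree_eq (p' : S.Op 0) (s : S.FinTree) :
    ∃ n, ∀ k, n ≤ k → Tree.cut p' k s.toTree = s := by
  induction s with
  | mk a f ih =>
    choose N hN using ih
    refine ⟨Finset.univ.sup N + 1, fun k hk => ?_⟩
    obtain ⟨k, rfl⟩ : ∃ j, k = j + 1 := ⟨k - 1, by omega⟩
    refine congrArg FinTree.mk (a₂ := (⟨a, f⟩ : S.poly S.FinTree)) ?_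
    refine (congrArg (S.poly.map _) (Tree.dest_toTree_mk (⟨a, f⟩ : S.poly S.FinTree))).trans ?_
    refine Sigma.ext rfl (heq_of_eq (funext fun i => ?_))
    exact hN i k ((Finset.le_sup (Finset.mem_univ i)).trans (Nat.le_of_succ_le_succ hk))

end Signature

open Signature

/-! ### The terminal-coalgebra chain and behavioural equivalence -/

section Coalgebras

variable {F : Type u ⥤ Type u}

/-- The chain `F^n 1` has connecting maps with which the cones `t_n` of all coalgebras are
compatible. -/
theorem exists_termCone_comp (n : ℕ) :
    ∃ r : termObj F (n + 1) ⟶ termObj F n,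
      ∀ C : Endofunctor.Coalgebra F, termCone C (n + 1) ≫ r = termCone C n := by
  induction n with
  | zero => exact ⟨TypeCat.ofHom fun _ => PUnit.unit, fun C => rfl⟩
  | succ n ih =>
    obtain ⟨r, hr⟩ := ih
    refine ⟨F.map r, fun C => ?_⟩
    change (C.str ≫ F.map (termCone C (n + 1))) ≫ F.map r = C.str ≫ F.map (termCone C n)
    rw [Category.assoc, ← F.map_comp, hr]

theorem termCone_eq_of_le {C : Endofunctor.Coalgebra F} {x y : C.V} {n k : ℕ} (hnk : n ≤ k)
    (h : termCone C k x = termCone C k y) : termCone C n x = termCone C n y := by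
  induction hnk with
  | refl => exact h
  | @step k _ ih =>
    obtain ⟨r, hr⟩ := exists_termCone_comp (F := F) k
    refine ih ?_
    have h' := congrArg r h
    rw [← hr C]
    exact h'

theorem termCone_comp_hom {C D : Endofunctor.Coalgebra F} (f : C ⟶ D) (n : ℕ) :
    f.f ≫ termCone D n = termCone C n := by
  induction n with
  | zero => rfl
  | succ n ih =>
    change f.f ≫ D.str ≫ F.map (termCone D n) = C.str ≫ F.map (termCone C n)
    rw [← ih, F.map_comp, ← Category.assoc, ← f.h, Category.assoc]

theorem termCone_hom_apply {C D : Endofunctor.Coalgebra F} (f : C ⟶ D) (n : ℕ) (x : C.V) :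
    termCone D n (f.f x) = termCone C n x :=
  ConcreteCategory.congr_hom (termCone_comp_hom f n) x

/-- Two states of a coalgebra are behaviourally equivalent if all the maps `t_n` into the
terminal-coalgebra chain identify them. -/
def behaviour (C : Endofunctor.Coalgebra F) : Setoid C.V where
  r x y := ∀ n, termCone C n x = termCone C n y
  iseqv := ⟨fun _ _ => rfl, fun h n => (h n).symm, fun h h' n => (h n).trans (h' n)⟩

end Coalgebras

namespace Presentation

variable {F : Type u ⥤ Type u} (P : Presentation F)

/-! ### The terminal coalgebra -/

theorem map_ε {X Y : Type u} (f : X ⟶ Y) (a : P.sig.poly X) :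
    F.map f (P.ε.app X a) = P.ε.app Y (P.sig.poly.map f a) :=
  (NatTrans.naturality_apply P.ε f a).symm

/-- `F t` is injective on the elements of `F X` that are supported by a set on which `t` has a left
inverse `r`. Only the arguments of `a` and `b` matter, so `F` need not preserve any injection. -/
theorem ε_eq_of_leftInvOn {X Y : Type u} (t : X ⟶ Y) (r : Y ⟶ X) (a b : P.sig.poly X)
    (ha : ∀ i, r (t (a.2 i)) = a.2 i) (hb : ∀ i, r (t (b.2 i)) = b.2 i)
    (h : F.map t (P.ε.app X a) = F.map t (P.ε.app X b)) : P.ε.app X a = P.ε.app X b := by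
  have key : ∀ c : P.sig.poly X, (∀ i, r (t (c.2 i)) = c.2 i) →
      F.map r (F.map t (P.ε.app X c)) = P.ε.app X c := by
    rintro ⟨c, g⟩ hc
    refine (congrArg (F.map r) (P.map_ε t _)).trans ((P.map_ε r _).trans ?_)
    refine congrArg (P.ε.app X) ?_
    exact Sigma.ext rfl (heq_of_eq (funext hc))
  rw [← key a ha, ← key b hb, h]

/-- The coalgebra structure descends to the quotient modulo behavioural equivalence. An element of
`F Q` has finite support, on which a single one of the maps `Q → F^n 1` is already injective, hence
has a left inverse. -/
theorem map_mk_str_eq (P : Presentation F) (C : Endofunctor.Coalgebra F) {x y : C.V}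
    (hxy : behaviour C x y) :
    F.map (TypeCat.ofHom (Quotient.mk (behaviour C))) (C.str x) =
      F.map (TypeCat.ofHom (Quotient.mk (behaviour C))) (C.str y) := by
  classical
  obtain ⟨a, ha⟩ := P.surj _ (F.map (TypeCat.ofHom (Quotient.mk (behaviour C))) (C.str x))
  obtain ⟨b, hb⟩ := P.surj _ (F.map (TypeCat.ofHom (Quotient.mk (behaviour C))) (C.str y))
  let Q : Type u := Quotient (behaviour C)
  let t (n : ℕ) : Q ⟶ termObj F n :=
    TypeCat.ofHom (Quotient.lift (termCone C n) fun _ _ h => h n)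
  have ht (n : ℕ) : TypeCat.ofHom (Quotient.mk (behaviour C)) ≫ t n = termCone C n := rfl
  have hsep : ∀ u v : Q, ∃ n, ∀ k, n ≤ k → t k u = t k v → u = v := by
    intro u v
    induction u using Quotient.inductionOn with
    | h u =>
    induction v using Quotient.inductionOn with
    | h v =>
    by_cases h : ∀ n, termCone C n u = termCone C n v
    · exact ⟨0, fun _ _ _ => Quotient.sound h⟩
    · obtain ⟨n, hn⟩ := not_forall.mp h
      exact ⟨n, fun k hk huv => absurd (termCone_eq_of_le hk huv) hn⟩
  choose N hN using hsep
  let a' : P.sig.poly Q := a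
  let b' : P.sig.poly Q := b
  let K : Finset Q := Finset.univ.image a'.2 ∪ Finset.univ.image b'.2
  let n : ℕ := (K ×ˢ K).sup fun q => N q.1 q.2
  have hinj : Set.InjOn (t n) (K : Set Q) := fun u hu v hv huv =>
    hN u v n (Finset.le_sup (f := fun q : Q × Q => N q.1 q.2)
      (Finset.mk_mem_product hu hv)) huv
  have : Nonempty Q := ⟨Quotient.mk _ x⟩
  let r : termObj F n ⟶ Q := TypeCat.ofHom (Function.invFunOn (t n) (K : Set Q))
  have hr : ∀ u ∈ K, r (t n u) = u := fun u hu => hinj.leftInvOn_invFunOn hu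
  rw [← ha, ← hb]
  refine P.ε_eq_of_leftInvOn (t n) r a' b'
    (fun i => hr _ (Finset.mem_union_left _ (Finset.mem_image_of_mem _ (Finset.mem_univ i))))
    (fun i => hr _ (Finset.mem_union_right _ (Finset.mem_image_of_mem _ (Finset.mem_univ i)))) ?_
  change F.map (t n) (P.ε.app _ a) = F.map (t n) (P.ε.app _ b)
  rw [ha, hb, ← Functor.map_comp_apply, ← Functor.map_comp_apply, ht]
  exact hxy (n + 1)

/-- The quotient of a coalgebra modulo behavioural equivalence. -/
def behaviourQuotient (C : Endofunctor.Coalgebra F) : Endofunctor.Coalgebra F :=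
  ⟨Quotient (behaviour C), TypeCat.ofHom (Quotient.lift
    (fun x => F.map (TypeCat.ofHom (Quotient.mk (behaviour C))) (C.str x))
    fun _ _ h => P.map_mk_str_eq C h)⟩

/-- The quotient map onto the quotient modulo behavioural equivalence. -/
def toBehaviourQuotient (C : Endofunctor.Coalgebra F) : C ⟶ P.behaviourQuotient C :=
  ⟨TypeCat.ofHom (Quotient.mk (behaviour C)), rfl⟩

theorem behaviourQuotient_eq {C : Endofunctor.Coalgebra F} {x y : (P.behaviourQuotient C).V}
    (h : ∀ n, termCone (P.behaviourQuotient C) n x = termCone (P.behaviourQuotient C) n y) :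
    x = y := by
  obtain ⟨x, rfl⟩ := Quotient.exists_rep x
  obtain ⟨y, rfl⟩ := Quotient.exists_rep y
  refine Quotient.sound fun n => ?_
  have := h n
  rwa [← termCone_hom_apply (P.toBehaviourQuotient C),
    ← termCone_hom_apply (P.toBehaviourQuotient C)]

/-- The canonical map into the limit of the terminal-coalgebra chain is injective on the terminal
coalgebra of a finitary functor. -/
theorem eq_of_termCone_eq (P : Presentation F) {T : Endofunctor.Coalgebra F} (hT : IsTerminal T)
    {x y : T.V}
    (h : ∀ n, termCone T n x = termCone T n y) : x = y := by
  have hid : P.toBehaviourQuotient T ≫ hT.from _ = 𝟙 T := hT.hom_ext _ _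
  have hid' : ∀ z : T.V, (hT.from _).f ((P.toBehaviourQuotient T).f z) = z := fun z =>
    ConcreteCategory.congr_hom (congrArg Endofunctor.Coalgebra.Hom.f hid) z
  rw [← hid' x, ← hid' y]
  exact congrArg _ (Quotient.sound h)

/-- Every `F`-coalgebra maps into the coalgebra of all trees: choose a representation by operation
symbols of the one-step behaviour of every state, and unfold. -/
noncomputable def unfold (C : Endofunctor.Coalgebra F) : C ⟶ P.treeCoalgebra where
  f := TypeCat.ofHom (PFunctor.M.corec (F := P.sig.poly)
    fun x => Function.surjInv (P.surj C.V) (C.str x))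
  h := by
    ext x
    change F.map _ (C.str x) = P.ε.app P.sig.Tree (PFunctor.M.dest (PFunctor.M.corec _ x))
    rw [PFunctor.M.dest_corec]
    refine Eq.trans ?_ (P.map_ε (TypeCat.ofHom (PFunctor.M.corec (F := P.sig.poly)
      fun x => Function.surjInv (P.surj C.V) (C.str x))) _)
    exact congrArg (F.map _) (Function.surjInv_eq (P.surj C.V) (C.str x)).symm

/-- The terminal coalgebra: all trees modulo behavioural equivalence. -/
noncomputable def isTerminalBehaviourQuotient : IsTerminal (P.behaviourQuotient P.treeCoalgebra) :=
  IsTerminal.ofUniqueHom (fun C => P.unfold C ≫ P.toBehaviourQuotient _) fun C g => by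
    ext x
    refine P.behaviourQuotient_eq fun n => ?_
    exact (termCone_hom_apply _ n x).trans (termCone_hom_apply _ n x).symm

theorem surjective_quot {T : Endofunctor.Coalgebra F} (hT : IsTerminal T) :
    Function.Surjective (P.quot hT) := fun y =>
  ⟨(P.unfold T).f y, ConcreteCategory.congr_hom (congrArg Endofunctor.Coalgebra.Hom.f
    (hT.hom_ext (P.unfold T ≫ hT.from _) (𝟙 T))) y⟩

theorem str_quot {T : Endofunctor.Coalgebra F} (hT : IsTerminal T) (s : P.sig.Tree) :
    T.str (P.quot hT s) = P.ε.app T.V (P.sig.poly.map (P.quot hT) s.dest) :=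
  (ConcreteCategory.congr_hom (hT.from P.treeCoalgebra).h s).symm.trans (P.map_ε _ _)

/-! ### The initial algebra -/

/-- The value of a finite tree in an `F`-algebra, regarded as a `Σ`-algebra via `ε`. -/
def eval (A : Endofunctor.Algebra F) : P.sig.FinTree → A.a
  | WType.mk a f => A.str (P.ε.app A.a (⟨a, fun i => eval A (f i)⟩ : P.sig.poly A.a))

theorem eval_mk (A : Endofunctor.Algebra F) (a : P.sig.H.obj P.sig.FinTree) :
    P.eval A (FinTree.mk a) = A.str (P.ε.app A.a (P.sig.poly.map (P.eval A) a)) := by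
  obtain ⟨a, f⟩ := a
  rfl

theorem hom_eval {A B : Endofunctor.Algebra F} (f : A ⟶ B) (s : P.sig.FinTree) :
    f.f (P.eval A s) = P.eval B s := by
  induction s with
  | mk a g ih =>
    have h := ConcreteCategory.congr_hom f.h
      (P.ε.app A.a (P.sig.poly.map (P.eval A) (⟨a, g⟩ : P.sig.poly P.sig.FinTree)))
    refine h.symm.trans ?_
    refine (congrArg B.str (P.map_ε f.f _)).trans ?_
    refine congrArg (fun c => B.str (P.ε.app B.a c)) ?_
    exact Sigma.ext rfl (heq_of_eq (funext ih))

variable {P} in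
theorem Cong.eval_eq {s t : P.sig.FinTree} (h : P.Cong s t) (A : Endofunctor.Algebra F) :
    P.eval A s = P.eval A t := by
  induction h with
  | eqn a b h =>
    rw [eval_mk, eval_mk]
    have h' := congrArg (F.map (TypeCat.ofHom (P.eval A))) h
    exact congrArg A.str ((P.map_ε _ _).symm.trans (h'.trans (P.map_ε _ _)))
  | app σ s t _ ih =>
    rw [eval_mk, eval_mk]
    refine congrArg (fun c => A.str (P.ε.app A.a c)) ?_
    exact Sigma.ext rfl (heq_of_eq (funext ih))
  | refl s => rfl
  | symm _ ih => exact ih.symm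
  | trans _ _ ih ih' => exact ih.trans ih'

/-- The congruence `∼` as an equivalence relation. -/
def congSetoid : Setoid P.sig.FinTree := ⟨P.Cong, Cong.refl, Cong.symm, Cong.trans⟩

/-- The algebra of finite trees modulo `∼`. Its structure map sends an element of `F Q` to the class
of a tree tupled from a chosen `ε`-preimage and chosen representatives of the classes in it. -/
noncomputable def congQuotient : Endofunctor.Algebra F :=
  ⟨Quotient P.congSetoid, TypeCat.ofHom fun a => Quotient.mk P.congSetoid (FinTree.mk
    (P.sig.poly.map Quotient.out (Function.surjInv (P.surj (Quotient P.congSetoid)) a)))⟩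

/-- Since the quotient map has a section, two elements of `H_Σ (μ H_Σ)` that are merged in `F Q` are
merged by `ε` after replacing all arguments by the chosen representatives of their classes. -/
theorem congQuotient_str_ε (a : P.sig.H.obj P.sig.FinTree) :
    P.congQuotient.str (P.ε.app _ (P.sig.poly.map (Quotient.mk P.congSetoid) a)) =
      Quotient.mk P.congSetoid (FinTree.mk a) := by
  refine Quotient.sound (Cong.trans (Cong.eqn _
    (P.sig.poly.map (fun s => (Quotient.mk P.congSetoid s).out) a) ?_) ?_)
  · have h := Function.surjInv_eq (P.surj _)
      (P.ε.app _ (P.sig.poly.map (Quotient.mk P.congSetoid) a))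
    have h' := congrArg (F.map (TypeCat.ofHom (Quotient.out (s := P.congSetoid)))) h
    refine (P.map_ε _ _).symm.trans (h'.trans ((P.map_ε _ _).trans (congrArg (P.ε.app _) ?_)))
    exact PFunctor.map_map _ _ _ _
  · obtain ⟨⟨n, σ⟩, f⟩ := a
    exact Cong.app σ _ _ fun i => Quotient.mk_out (s := P.congSetoid) (f i)

theorem eval_congQuotient (s : P.sig.FinTree) :
    P.eval P.congQuotient s = Quotient.mk P.congSetoid s := by
  induction s with
  | mk a f ih =>
    refine Eq.trans (congrArg (fun c => P.congQuotient.str (P.ε.app _ c)) ?_)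
      (P.congQuotient_str_ε ⟨a, f⟩)
    exact Sigma.ext rfl (heq_of_eq (funext ih))

/-- The homomorphism from the algebra of finite trees modulo `∼` induced by evaluation. -/
def congQuotientDesc (A : Endofunctor.Algebra F) : P.congQuotient ⟶ A where
  f := TypeCat.ofHom (Quotient.lift (P.eval A) fun _ _ h => Cong.eval_eq h A)
  h := by
    ext a
    obtain ⟨b, rfl⟩ := P.surj _ a
    obtain ⟨c, rfl⟩ : ∃ c, P.sig.poly.map (Quotient.mk P.congSetoid) c = b := by
      refine ⟨P.sig.poly.map Quotient.out b, ?_⟩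
      obtain ⟨b, f⟩ := b
      exact Sigma.ext rfl (heq_of_eq (funext fun i => Quotient.out_eq (f i)))
    refine (congrArg A.str (P.map_ε _ _)).trans ?_
    refine Eq.trans ?_ (congrArg (Quotient.lift (P.eval A) fun _ _ h => Cong.eval_eq h A)
      (P.congQuotient_str_ε c)).symm
    refine Eq.trans ?_ (P.eval_mk A c).symm
    exact congrArg (fun d => A.str (P.ε.app _ d)) (PFunctor.map_map _ _ _ c)

/-- The initial algebra: finite trees modulo `∼`. -/
noncomputable def isInitialCongQuotient : IsInitial P.congQuotient :=
  IsInitial.ofUniqueHom P.congQuotientDesc fun A g => by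
    ext s
    obtain ⟨s, rfl⟩ := Quotient.exists_rep s
    rw [← eval_congQuotient]
    exact (P.hom_eval g s).trans (P.hom_eval _ s).symm

theorem surjective_eval {I : Endofunctor.Algebra F} (hI : IsInitial I) :
    Function.Surjective (P.eval I) := fun x => by
  obtain ⟨s, hs⟩ := Quotient.exists_rep ((hI.to P.congQuotient).f x)
  refine ⟨s, ?_⟩
  rw [← P.hom_eval (P.congQuotientDesc I), eval_congQuotient]
  refine (congrArg _ hs).trans ?_
  exact ConcreteCategory.congr_hom (congrArg Endofunctor.Algebra.Hom.f
    (hI.hom_ext (hI.to _ ≫ P.congQuotientDesc I) (𝟙 I))) x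

end Presentation

/-! ### Cutting maps and solutions of recursive equations -/

section Cutting

variable {F : Type u ⥤ Type u} {I : Endofunctor.Algebra F} {T : Endofunctor.Coalgebra F}

theorem incl_hom (hI : IsInitial I) (hT : IsTerminal T) :
    I.str ≫ incl hI hT ≫ T.str = F.map (incl hI hT) := by
  have h : Endofunctor.Algebra.Initial.strInv hI ≫ F.map (incl hI hT) = incl hI hT ≫ T.str :=
    (hT.from ⟨I.a, Endofunctor.Algebra.Initial.strInv hI⟩).h
  rw [← h, ← Category.assoc, Endofunctor.Algebra.Initial.right_inv, Category.id_comp]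

theorem str_strInv (hT : IsTerminal T) (a : F.obj T.V) :
    T.str (Endofunctor.Coalgebra.Terminal.strInv hT a) = a :=
  ConcreteCategory.congr_hom (Endofunctor.Coalgebra.Terminal.left_inv hT) a

theorem str_injective (hT : IsTerminal T) : Function.Injective T.str := fun x y h => by
  have key := ConcreteCategory.congr_hom (Endofunctor.Coalgebra.Terminal.right_inv hT)
  exact (key x).symm.trans ((congrArg (Endofunctor.Coalgebra.Terminal.strInv hT) h).trans (key y))

theorem cutMap_succ (p : F.obj PEmpty.{u + 1}) (n : ℕ) :
    cutMap I T p (n + 1) = T.str ≫ F.map (cutMap I T p n) ≫ I.str := by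
  change (T.str ≫ F.map (termCone T n)) ≫ F.map (powPoint p n) ≫
    F.map (initCocone I (n + 1)) ≫ I.str = _
  rw [cutMap, F.map_comp, F.map_comp]
  simp only [Category.assoc]

/-- Cutting an element of `ν F` at height `n` does not change its image in `F^n 1`. -/
theorem cutMap_incl_termCone (hI : IsInitial I) (hT : IsTerminal T) (p : F.obj PEmpty.{u + 1})
    (n : ℕ) : cutMap I T p n ≫ incl hI hT ≫ termCone T n = termCone T n := by
  induction n with
  | zero => rfl
  | succ n ih =>
    change cutMap I T p (n + 1) ≫ incl hI hT ≫ T.str ≫ F.map (termCone T n) =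
      T.str ≫ F.map (termCone T n)
    calc cutMap I T p (n + 1) ≫ incl hI hT ≫ T.str ≫ F.map (termCone T n)
        = T.str ≫ F.map (cutMap I T p n) ≫ (I.str ≫ incl hI hT ≫ T.str) ≫
            F.map (termCone T n) := by
          rw [cutMap_succ]
          simp only [Category.assoc]
      _ = T.str ≫ F.map (cutMap I T p n ≫ incl hI hT ≫ termCone T n) := by
          rw [incl_hom, F.map_comp, F.map_comp]
      _ = T.str ≫ F.map (termCone T n) := by rw [ih]

theorem approx_eq_cutMap (hT : IsTerminal T) (p : F.obj PEmpty.{u + 1}) {X : Type u}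
    {e : X → F.obj X ⊕ T.V} {s : X → T.V} (hs : IsSolution (terminalAlgebra hT) e s) (k : ℕ)
    (x : X) : approx I T p e k x = cutMap I T p k (s x) := by
  induction k generalizing x with
  | zero => rfl
  | succ k ih =>
    have hs' := hs x
    change Sum.elim _ id (Sum.map id _ (e x)) = _
    rcases he : e x with a | y
    · rw [he] at hs'
      have hstr : T.str (s x) = F.map (TypeCat.ofHom s) a := by
        rw [hs']
        exact str_strInv hT _
      have hk : (TypeCat.ofHom (approx I T p e k) : X ⟶ I.a) =
          TypeCat.ofHom s ≫ cutMap I T p k := by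
        ext x
        exact ih x
      rw [cutMap_succ]
      change I.str (F.map (TypeCat.ofHom (approx I T p e k)) a) =
        I.str (F.map (cutMap I T p k) (T.str (s x)))
      rw [hstr, hk, Functor.map_comp_apply]
    · rw [he] at hs'
      exact congrArg (cutMap I T p (k + 1)) hs'.symm

/-- A solution is obtained by turning `X + ν F` into a coalgebra, whose restriction to `ν F` is
`τ`, and restricting its homomorphism into `ν F` to `X`. -/
theorem exists_isSolution (hT : IsTerminal T) {X : Type u} (e : X → F.obj X ⊕ T.V) :
    ∃ s : X → T.V, IsSolution (terminalAlgebra hT) e s := by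
  let inl' : X ⟶ (X ⊕ T.V : Type u) := TypeCat.ofHom Sum.inl
  let inr' : T.V ⟶ (X ⊕ T.V : Type u) := TypeCat.ofHom Sum.inr
  let c : X ⊕ T.V → F.obj (X ⊕ T.V : Type u) :=
    Sum.elim (fun x => Sum.elim (F.map inl') (fun y => F.map inr' (T.str y)) (e x))
      (fun y => F.map inr' (T.str y))
  let C : Endofunctor.Coalgebra F := ⟨(X ⊕ T.V : Type u), TypeCat.ofHom c⟩
  let j : T ⟶ C := ⟨inr', rfl⟩
  let h : C ⟶ T := hT.from C
  have hj : inr' ≫ h.f = 𝟙 T.V :=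
    congrArg Endofunctor.Coalgebra.Hom.f (hT.hom_ext (j ≫ h) (𝟙 T))
  refine ⟨fun x => h.f (Sum.inl x), fun x => ?_⟩
  have hx : T.str (h.f (Sum.inl x)) = F.map h.f (c (Sum.inl x)) :=
    (congrArg (fun f : C.V ⟶ F.obj T.V => f (Sum.inl x : X ⊕ T.V)) h.h).symm
  apply str_injective hT
  rw [hx]
  change F.map h.f (Sum.elim _ _ (e x)) = _
  rcases e x with a | y
  · refine (Functor.map_comp_apply F inl' h.f a).symm.trans ?_
    exact (str_strInv hT _).symm
  · refine (Functor.map_comp_apply F inr' h.f (T.str y)).symm.trans ?_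
    rw [hj, Functor.map_id_apply]
    rfl

end Cutting

/-! ### The order by cutting -/

namespace Presentation

open Signature

variable {F : Type u ⥤ Type u} (P : Presentation F) {I : Endofunctor.Algebra F}
  {T : Endofunctor.Coalgebra F}

theorem incl_eval (hI : IsInitial I) (hT : IsTerminal T) (s : P.sig.FinTree) :
    incl hI hT (P.eval I s) = P.quot hT s.toTree := by
  induction s with
  | mk a f ih =>
    apply str_injective hT
    refine (ConcreteCategory.congr_hom (incl_hom hI hT) (P.ε.app I.a
      (⟨a, fun i => P.eval I (f i)⟩ : P.sig.poly I.a))).trans ?_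
    refine (P.map_ε _ _).trans ?_
    refine Eq.trans ?_ (P.str_quot hT (FinTree.mk (⟨a, f⟩ : P.sig.poly P.sig.FinTree)).toTree).symm
    refine congrArg (P.ε.app T.V) ?_
    exact Sigma.ext rfl (heq_of_eq (funext ih))

/-- The cutting map on `ν F` is induced by the cutting of trees. -/
theorem cutMap_quot (p' : P.sig.Op 0) (hT : IsTerminal T) (n : ℕ) (s : P.sig.Tree) :
    cutMap I T (P.point p') n (P.quot hT s) = P.eval I (s.cut p' n) := by
  induction n generalizing s with
  | zero =>
    refine Eq.trans ?_ (P.eval_mk I (P.sig.op p' Fin.elim0)).symm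
    refine congrArg I.str ((P.map_ε _ _).trans (congrArg (P.ε.app I.a) ?_))
    exact Sigma.ext rfl (heq_of_eq (funext fun i => i.elim0))
  | succ n ih =>
    rw [cutMap_succ]
    refine Eq.trans ?_ (P.eval_mk I (P.sig.poly.map (Tree.cut p' n) s.dest)).symm
    refine congrArg I.str ((congrArg (F.map (cutMap I T (P.point p') n)) (P.str_quot hT s)).trans
      ((P.map_ε _ _).trans (congrArg (P.ε.app I.a) ?_)))
    exact Sigma.ext rfl (heq_of_eq (funext fun i => ih _))

theorem cutMap_incl_cutMap (p' : P.sig.Op 0) (hI : IsInitial I) (hT : IsTerminal T) (n k : ℕ)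
    (y : T.V) : cutMap I T (P.point p') n (incl hI hT (cutMap I T (P.point p') k y)) =
      cutMap I T (P.point p') (min n k) y := by
  obtain ⟨s, rfl⟩ := P.surjective_quot hT y
  rw [cutMap_quot, incl_eval, cutMap_quot, Tree.cut_toTree_cut, cutMap_quot]

theorem exists_forall_cutMap_incl_eq (p' : P.sig.Op 0) (hI : IsInitial I) (hT : IsTerminal T)
    (x : I.a) : ∃ n, ∀ k, n ≤ k → cutMap I T (P.point p') k (incl hI hT x) = x := by
  obtain ⟨s, rfl⟩ := P.surjective_eval hI x
  obtain ⟨n, hn⟩ := FinTree.exists_forall_cut_toTree_eq p' s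
  exact ⟨n, fun k hk => by rw [incl_eval, cutMap_quot, hn k hk]⟩

theorem injective_incl (p' : P.sig.Op 0) (hI : IsInitial I) (hT : IsTerminal T) :
    Function.Injective (incl hI hT) := fun x y h => by
  obtain ⟨n, hn⟩ := P.exists_forall_cutMap_incl_eq p' hI hT x
  obtain ⟨k, hk⟩ := P.exists_forall_cutMap_incl_eq p' hI hT y
  rw [← hn _ (le_max_left n k), ← hk _ (le_max_right n k), h]

/-- An element of `ν F` is determined by its cuttings. -/
theorem eq_of_cutMap_eq (P : Presentation F) (p : F.obj PEmpty.{u + 1}) (hI : IsInitial I)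
    (hT : IsTerminal T) {y z : T.V} (h : ∀ k, cutMap I T p k y = cutMap I T p k z) : y = z := by
  refine P.eq_of_termCone_eq hT fun n => ?_
  have key := ConcreteCategory.congr_hom (cutMap_incl_termCone hI hT p n)
  rw [← key y, ← key z]
  exact congrArg (fun w => termCone T n (incl hI hT w)) (h n)

/-- The order by cutting without reference to trees: the elements below `y` are `y` itself and its
cuttings. -/
theorem cutLE_iff (p' : P.sig.Op 0) (hI : IsInitial I) (hT : IsTerminal T) {x y : T.V} :
    P.CutLE p' hT x y ↔ x = y ∨ ∃ n, incl hI hT (cutMap I T (P.point p') n y) = x := by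
  refine or_congr Iff.rfl ⟨?_, ?_⟩
  · rintro ⟨s, s', n, rfl, rfl, h⟩
    exact ⟨n, by rw [cutMap_quot, ← h.eval_eq I, incl_eval]⟩
  · rintro ⟨n, rfl⟩
    obtain ⟨s, rfl⟩ := P.surjective_quot hT y
    exact ⟨s.cut p' n, s, n, by rw [cutMap_quot, incl_eval], rfl, Cong.refl _⟩

/-- The order by cutting as a partial order on `ν F`. -/
abbrev cutOrder (p' : P.sig.Op 0) (hI : IsInitial I) (hT : IsTerminal T) : PartialOrder T.V where
  le := P.CutLE p' hT
  le_refl x := Or.inl rfl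
  le_trans x y z hxy hyz := by
    rw [P.cutLE_iff p' hI hT] at *
    rcases hxy with rfl | ⟨n, rfl⟩
    · exact hyz
    · rcases hyz with rfl | ⟨k, rfl⟩
      · exact Or.inr ⟨n, rfl⟩
      · exact Or.inr ⟨min n k, by rw [cutMap_incl_cutMap]⟩
  le_antisymm x y hxy hyx := by
    rw [P.cutLE_iff p' hI hT] at *
    rcases hxy with hxy | ⟨n, hn⟩
    · exact hxy
    rcases hyx with hyx | ⟨k, hk⟩
    · exact hyx.symm
    -- Both `x` and `y` are the cutting of `x`, and of `y`, at the smaller of the two heights.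
    have hx : incl hI hT (cutMap I T (P.point p') (min n k) x) = x := by
      rw [← cutMap_incl_cutMap P p' hI hT, hk, hn]
    have hy : incl hI hT (cutMap I T (P.point p') (min k n) y) = y := by
      rw [← cutMap_incl_cutMap P p' hI hT, hn, hk]
    rcases le_total n k with h | h
    · rw [min_eq_right h] at hy
      exact hn.symm.trans hy
    · rw [min_eq_right h] at hx
      exact hx.symm.trans hk

theorem cutLE_incl_cutMap_of_le (p' : P.sig.Op 0) (hI : IsInitial I) (hT : IsTerminal T) {n k : ℕ}
    (hnk : n ≤ k) (y : T.V) :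
    P.CutLE p' hT (incl hI hT (cutMap I T (P.point p') n y))
      (incl hI hT (cutMap I T (P.point p') k y)) := by
  rw [P.cutLE_iff p' hI hT]
  exact Or.inr ⟨n, by rw [cutMap_incl_cutMap, min_eq_left hnk]⟩

/-- Every element of `ν F` is the least upper bound of its cuttings. If `z` is an upper bound of the
cuttings of `y` and `y ≠ z`, then `y` and `z` have distinct cuttings at some height `K`. From `K`
onwards the cuttings of `y` are cuttings of `z` at heights below `K`, so they are all equal, and
`y` itself is a cutting of `z`. -/
theorem cutLE_of_forall_incl_cutMap (p' : P.sig.Op 0) (hI : IsInitial I) (hT : IsTerminal T)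
    {y z : T.V} (h : ∀ k, P.CutLE p' hT (incl hI hT (cutMap I T (P.point p') k y)) z) :
    P.CutLE p' hT y z := by
  simp only [P.cutLE_iff p' hI hT] at h ⊢
  by_cases hyz : ∀ k, cutMap I T (P.point p') k y = cutMap I T (P.point p') k z
  · exact Or.inl (P.eq_of_cutMap_eq _ hI hT hyz)
  obtain ⟨K, hK⟩ := not_forall.mp hyz
  -- Above `K` the cuttings of `y` stay constant, with value a cutting of `z`.
  have key : ∀ k, K ≤ k → cutMap I T (P.point p') k y = cutMap I T (P.point p') K y := by
    intro k hk
    have hKk : cutMap I T (P.point p') K (incl hI hT (cutMap I T (P.point p') k y)) =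
        cutMap I T (P.point p') K y := by rw [cutMap_incl_cutMap, min_eq_left hk]
    rcases h k with hz | ⟨n, hn⟩
    · exact absurd (hz ▸ hKk).symm hK
    · rw [← hn, cutMap_incl_cutMap] at hKk
      rcases le_total K n with hKn | hnK
      · rw [min_eq_left hKn] at hKk
        exact absurd hKk.symm hK
      · rw [min_eq_right hnK] at hKk
        exact (P.injective_incl p' hI hT hn).symm.trans hKk
  have hy : y = incl hI hT (cutMap I T (P.point p') K y) := by
    refine P.eq_of_cutMap_eq (P.point p') hI hT fun j => ?_
    rw [cutMap_incl_cutMap]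
    rcases le_total j K with hj | hj
    · rw [min_eq_left hj]
    · rw [min_eq_right hj, key j hj]
  rw [hy]
  exact h K

end Presentation

end IterAlg

theorem mainTheorem1 (F : Type u ⥤ Type u) [PreservesFilteredColimits F]
    (_hF : Nonempty (F.obj PEmpty.{u + 1}))
    (P : IterAlg.Presentation F) (p' : P.sig.Op 0) :
    (∃ I : Endofunctor.Algebra F, Nonempty (IsInitial I)) ∧
    (∃ T : Endofunctor.Coalgebra F, Nonempty (IsTerminal T)) ∧
    ∀ (I : Endofunctor.Algebra F) (hI : IsInitial I)
      (T : Endofunctor.Coalgebra F) (hT : IsTerminal T),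
      Function.Injective (IterAlg.incl hI hT) ∧
      ∃ _ : PartialOrder T.V,
        (∀ x y : T.V, x ≤ y ↔ P.CutLE p' hT x y) ∧
        ∀ (X : Type u) (e : X → F.obj X ⊕ T.V),
          (∀ g : X → I.a,
            (fun x => IterAlg.incl hI hT (IterAlg.approx I T (P.point p') e 0 x)) ≤
              fun x => IterAlg.incl hI hT (g x)) ∧
          Monotone (fun (k : ℕ) (x : X) =>
            IterAlg.incl hI hT (IterAlg.approx I T (P.point p') e k x)) ∧
          ∃ s : X → T.V,
            (IterAlg.IsSolution (IterAlg.terminalAlgebra hT) e s ∧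
              ∀ s' : X → T.V, IterAlg.IsSolution (IterAlg.terminalAlgebra hT) e s' → s' = s) ∧
            IsLUB (Set.range fun (k : ℕ) (x : X) =>
              IterAlg.incl hI hT (IterAlg.approx I T (P.point p') e k x)) s := by
  refine ⟨⟨_, ⟨P.isInitialCongQuotient⟩⟩, ⟨_, ⟨P.isTerminalBehaviourQuotient⟩⟩,
    fun I hI T hT => ⟨P.injective_incl p' hI hT, P.cutOrder p' hI hT, fun _ _ => Iff.rfl,
      fun X e => ?_⟩⟩
  obtain ⟨s, hs⟩ := IterAlg.exists_isSolution hT e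
  have happrox : ∀ k x, IterAlg.approx I T (P.point p') e k x =
      IterAlg.cutMap I T (P.point p') k (s x) := IterAlg.approx_eq_cutMap hT _ hs
  refine ⟨fun g x => ?_, fun n k hnk x => ?_, s, ⟨hs, fun s' hs' => funext fun x => ?_⟩, ?_, ?_⟩
  · -- All elements have the same cutting at height `0`.
    exact (P.cutLE_iff p' hI hT).mpr (Or.inr ⟨0, rfl⟩)
  · change P.CutLE p' hT (IterAlg.incl hI hT _) (IterAlg.incl hI hT _)
    rw [happrox, happrox]
    exact P.cutLE_incl_cutMap_of_le p' hI hT hnk (s x)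
  · refine P.eq_of_cutMap_eq (P.point p') hI hT fun k => ?_
    rw [← happrox, ← IterAlg.approx_eq_cutMap hT _ hs']
  · rintro _ ⟨k, rfl⟩ x
    exact (P.cutLE_iff p' hI hT).mpr (Or.inr ⟨k, congrArg _ (happrox k x).symm⟩)
  · intro z hz x
    refine P.cutLE_of_forall_incl_cutMap p' hI hT fun k => ?_
    rw [← happrox]
    exact hz ⟨k, rfl⟩ x
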